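/- Let $M_0,\dots,M_s$ be $d\times d$ dilation matrices, i.e. integer matrices all of whose complex eigenvalues are greater than $1$ in modulus. Let $b_0:\mathbb Z^d\to\mathbb C^{r\times r}$, $b_1,\dots,b_s:\mathbb Z^d\to\mathbb C^{1\times r}$ and $u:\mathbb Z^d\to\mathbb C^{r}$ be finitely supported, and write $\widehat a(\xi)=\sum_{k\in\mathbb Z^d}a(k)e^{-ik\cdot\xi}$. Suppose that there are a matrix norm $|||\cdot|||$ and constants $C_0,C_b,\tau>0$ with $$\log_2\bigl(|||\widehat{b_0}(0)|||+C_0\bigr)\le\tau,\qquad \|\widehat{b_0}(\xi)\widehat u(\xi)-\widehat u(M_0^{T}\xi)\|\le C_b\|\xi\|^{\tau}\quad(\xi\in[-\pi,\pi]^d).$$ For a sequence $v:\mathbb Z^d\to\mathbb C^{1\times r}$ put $[\mathcal T_{b,M}v](n)=|\det M|^{1/2}\sum_{k}v(k)\overline{b(k-Mn)}^{T}$, $v_{0,0}=v$, $v_{l,j}=\mathcal T_{b_l,M_l}v_{0,j-1}$ ($0\le l\le s$, $j\ge1$) and $\mathcal W_Jv=(v_{1,1},\dots,v_{s,1},\dots,v_{1,J},\dots,v_{s,J},v_{0,J})$.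 Suppose that the filter bank $\{b_l!M_l\}_{l=0}^s$ is stable in $\ell_2$: there are $C_1,C_2>0$ such that $C_1\|v\|_{\ell_2}^2\le\|\mathcal W_Jv\|_{\ell_2}^2\le C_2\|v\|_{\ell_2}^2$ for all $J\ge1$ and all $v\in\ell_2(\mathbb Z^d)^{1\times r}$. Then, for every $\xi\in\mathbb R^d$, the limit $$\widehat{\psi^0}(\xi)=\lim_{n\to\infty}\widehat{b_0}(M_0^{-T}\xi)\,\widehat{b_0}((M_0^{-T})^2\xi)\cdots\widehat{b_0}((M_0^{-T})^n\xi)\,\widehat u((M_0^{-T})^n\xi)$$ exists; it is the Fourier transform of the standard $M_0$-refinable vector function $\psi^0$ of $b_0$ (and $u$). Moreover, with $\widehat{\psi^l}(\xi)=\widehat{b_l}(M_0^{-T}\xi)\widehat{\psi^0}(M_0^{-T}\xi)$ for $l=1,\dots,s$, there is a constant $C>0$ such that for almost every $\xi\in\mathbb R^d$ the bracket product below converges absolutely and $$[\widehat{\psi^0},\widehat{\psi^0}](\xi):=\sum_{k\in\mathbb Z^d}\widehat{\psi^0}(\xi+2\pi k)\overline{\widehat{\psi^0}(\xi+2\pi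 k)}^{T}\le C I_r,\qquad \sum_{l=1}^s\sum_{k\in\mathbb Z^d}\bigl|\widehat{\psi^l}\bigl(M_l^{-T}M_0^{T}(\xi+2\pi k)\bigr)\bigr|^2\le C,$$ where $A\le B$ means that $B-A$ is positive semidefinite. -/

import Mathlib

open Filter Topology MeasureTheory Matrix
open scoped ENNReal ComplexOrder

noncomputable section

namespace MixedFramelet

/-- A finitely supported filter `ℤ^d → E`; with `E` the `r × q` complex matrices these are the
matrix-valued filters, with `E = Fin r → ℂ` the column-vector-valued ones. -/
abbrev FinFilter (d : ℕ) (E : Type) [Zero E] : Type := (Fin d → ℤ) →₀ E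

/-- An integer `d × d` matrix all of whose (complex) eigenvalues are greater than `1` in modulus. -/
def IsDilation {d : ℕ} (M : Matrix (Fin d) (Fin d) ℤ) : Prop :=
  ∀ μ : ℂ, Module.End.HasEigenvalue (Matrix.toLin' (M.map (Int.cast : ℤ → ℂ))) μ → 1 < ‖μ‖

/-- The real matrix `Mᵀ`. -/
def transR {d : ℕ} (M : Matrix (Fin d) (Fin d) ℤ) : Matrix (Fin d) (Fin d) ℝ :=
  (M.map (Int.cast : ℤ → ℝ))ᵀ

/-- The real matrix `M⁻ᵀ`. -/
def invTransR {d : ℕ} (M : Matrix (Fin d) (Fin d) ℤ) : Matrix (Fin d) (Fin d) ℝ :=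
  (transR M)⁻¹

/-- The point `ξ + 2 π k`. -/
def shift {d : ℕ} (ξ : Fin d → ℝ) (k : Fin d → ℤ) : Fin d → ℝ :=
  fun i => ξ i + 2 * Real.pi * (k i : ℝ)

/-- The Fourier series `â(ξ) = ∑ₖ a(k) exp(-i k·ξ)` of a finitely supported filter. -/
def fourierSeries {d : ℕ} {E : Type} [AddCommGroup E] [Module ℂ E]
    (a : FinFilter d E) (ξ : Fin d → ℝ) : E :=
  a.sum fun k A => Complex.exp (-Complex.I * ((∑ i, (k i : ℝ) * ξ i : ℝ) : ℂ)) • A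

/-- The transition operator
`[T_{b,M} u](n) = |det M|^{1/2} ∑ₖ u(k) (conj b(k - M n))ᵀ` on row-vector-valued sequences
(the sum has only finitely many nonzero terms). -/
def transition {d r t : ℕ} (b : FinFilter d (Matrix (Fin t) (Fin r) ℂ))
    (M : Matrix (Fin d) (Fin d) ℤ) (u : (Fin d → ℤ) → Fin r → ℂ) :
    (Fin d → ℤ) → Fin t → ℂ :=
  fun n => ((Real.sqrt |(M.det : ℝ)| : ℝ) : ℂ) • ∑ᶠ k : Fin d → ℤ, u k ᵥ* (b (k - M *ᵥ n))ᴴ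

/-- The squared `ℓ₂`-norm (possibly `∞`) of a vector-valued sequence. -/
def sqNorm {d : ℕ} {ι : Type} [Fintype ι] (u : (Fin d → ℤ) → ι → ℂ) : ℝ≥0∞ :=
  ∑' k, ∑ i, ‖u k i‖ₑ ^ 2

/-- The low-pass coefficients `v_{0,0} = v`, `v_{0,j} = T_{b₀,M₀} v_{0,j-1}`. -/
def lowPass {d r : ℕ} (M₀ : Matrix (Fin d) (Fin d) ℤ)
    (b₀ : FinFilter d (Matrix (Fin r) (Fin r) ℂ)) (v : (Fin d → ℤ) → Fin r → ℂ) :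
    ℕ → (Fin d → ℤ) → Fin r → ℂ
  | 0 => v
  | j + 1 => transition b₀ M₀ (lowPass M₀ b₀ v j)

/-- The `J`-level analysis operator
`W_J v = (v_{1,1}, …, v_{s,1}, …, v_{1,J}, …, v_{s,J}, v_{0,J})`, a sequence of row vectors of
length `s J + r`, where `v_{l,j} = T_{b_l,M_l} v_{0,j-1}`. The coordinate `Sum.inl (j, l)` is
`v_{l+1,j+1}` since `Fin` counts from `0`. -/
def analysis {d r s : ℕ} (M₀ : Matrix (Fin d) (Fin d) ℤ)
    (M : Fin s → Matrix (Fin d) (Fin d) ℤ)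
    (b₀ : FinFilter d (Matrix (Fin r) (Fin r) ℂ))
    (b : Fin s → FinFilter d (Matrix (Fin 1) (Fin r) ℂ))
    (J : ℕ) (v : (Fin d → ℤ) → Fin r → ℂ) :
    (Fin d → ℤ) → (Fin J × Fin s) ⊕ Fin r → ℂ :=
  fun n => Sum.elim
    (fun p => transition (b p.2) (M p.2) (lowPass M₀ b₀ v p.1) n 0)
    (lowPass M₀ b₀ v J n)

/-- Stability in `ℓ₂` of the filter bank `{b_l ! M_l}`, `l = 0, …, s`. -/
def HasStability {d r s : ℕ} (M₀ : Matrix (Fin d) (Fin d) ℤ)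
    (M : Fin s → Matrix (Fin d) (Fin d) ℤ)
    (b₀ : FinFilter d (Matrix (Fin r) (Fin r) ℂ))
    (b : Fin s → FinFilter d (Matrix (Fin 1) (Fin r) ℂ)) : Prop :=
  ∃ C₁ C₂ : ℝ, 0 < C₁ ∧ 0 < C₂ ∧
    ∀ J : ℕ, 1 ≤ J → ∀ v : (Fin d → ℤ) → Fin r → ℂ, sqNorm v < ∞ →
      ENNReal.ofReal C₁ * sqNorm v ≤ sqNorm (analysis M₀ M b₀ b J v) ∧
      sqNorm (analysis M₀ M b₀ b J v) ≤ ENNReal.ofReal C₂ * sqNorm v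

/-- The `n`-th term `(∏_{j=1}^n b̂₀((M₀⁻ᵀ)^j ξ)) û((M₀⁻ᵀ)^n ξ)` of the infinite product; the
factors are multiplied from left to right as `j` increases. -/
def partialProduct {d r : ℕ} (M₀ : Matrix (Fin d) (Fin d) ℤ)
    (b₀ : FinFilter d (Matrix (Fin r) (Fin r) ℂ)) (u : FinFilter d (Fin r → ℂ))
    (n : ℕ) (ξ : Fin d → ℝ) : Fin r → ℂ :=
  ((List.range n).map fun j => fourierSeries b₀ ((invTransR M₀ ^ (j + 1)) *ᵥ ξ)).prod *ᵥ
    fourierSeries u ((invTransR M₀ ^ n) *ᵥ ξ)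

/-- The Fourier transform of the standard `M₀`-refinable vector function `ψ⁰` associated with `b₀`
and `u`: the pointwise limit of the partial products. -/
def psiHatZero {d r : ℕ} (M₀ : Matrix (Fin d) (Fin d) ℤ)
    (b₀ : FinFilter d (Matrix (Fin r) (Fin r) ℂ)) (u : FinFilter d (Fin r → ℂ))
    (ξ : Fin d → ℝ) : Fin r → ℂ :=
  limUnder atTop fun n => partialProduct M₀ b₀ u n ξ

/-- The Fourier transform `b̂_l(M₀⁻ᵀ ξ) ψ̂⁰(M₀⁻ᵀ ξ)` of the function `ψˡ`, where `bl = b_l`. -/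
def psiHat {d r : ℕ} (M₀ : Matrix (Fin d) (Fin d) ℤ)
    (b₀ : FinFilter d (Matrix (Fin r) (Fin r) ℂ)) (u : FinFilter d (Fin r → ℂ))
    (bl : FinFilter d (Matrix (Fin 1) (Fin r) ℂ)) (ξ : Fin d → ℝ) : ℂ :=
  (fourierSeries bl (invTransR M₀ *ᵥ ξ) *ᵥ psiHatZero M₀ b₀ u (invTransR M₀ *ᵥ ξ)) 0

/-- The `k`-th term `f(ξ + 2πk) (conj g(ξ + 2πk))ᵀ` of the bracket product of column vectors. -/
def bracketTerm {d r : ℕ} (f g : (Fin d → ℝ) → Fin r → ℂ) (ξ : Fin d → ℝ) (k : Fin d → ℤ) :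
    Matrix (Fin r) (Fin r) ℂ :=
  vecMulVec (f (shift ξ k)) (star (g (shift ξ k)))

/-- The bracket product `[f, g](ξ) = ∑ₖ f(ξ + 2πk) (conj g(ξ + 2πk))ᵀ`. -/
def bracket {d r : ℕ} (f g : (Fin d → ℝ) → Fin r → ℂ) (ξ : Fin d → ℝ) :
    Matrix (Fin r) (Fin r) ℂ :=
  ∑' k, bracketTerm f g ξ k

end MixedFramelet

end

/-!
The key is the low-pass part of the upper stability bound, which says that the iterated transition
operators `v ↦ lowPass M₀ b₀ v n` are bounded on `ℓ₂` uniformly in `n`. On the Fourier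
side the iterate of level `n` acts through the matrix product
`cascade n ξ = b̂₀(M₀⁻ᵀ ξ) ⋯ b̂₀((M₀⁻ᵀ)ⁿ ξ)`, and its operator norm is the supremum over `ξ` of the
norm of the block row `(cascade n (ξ + 2πk))ₖ`, where `k` runs through `ℤᵈ / (M₀ᵀ)ⁿ ℤᵈ`. The
inequality needed from this, `euclSq_sum_cascade_le`, is obtained at every `ξ` and without
integration: an exponential sum with frequencies `(M₀⁻ᵀ)ⁿ (ξ + 2πkⱼ)` is, up to a unimodular factor,
periodic under `N ℤᵈ`, `N = M₀ⁿ`, so it can be cut off to a union of `N`-cosets over a large box.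
Its `ℓ₂` norm is then given by Parseval on the group `ℤᵈ / N ℤᵈ`, of order `|det N|`
(`sum_euclSq_expSum`), its image is again a multiple of an exponential, up to boundary effects
(`lowPass_expSum`, `exists_lowPass_window`), and the boundary disappears as the box grows.

For one frequency this says that the products `cascade n ξ` are bounded uniformly in `n`.
Consecutive partial products therefore differ by at most a constant times
`‖b̂₀(η) û(η) - û(M₀ᵀ η)‖ ≤ Cb ‖η‖^τ` with `η = (M₀⁻ᵀ)ⁿ⁺¹ ξ`, which decays geometrically because
`M₀⁻ᵀ` has spectral radius less than one; hence `tendsto_partialProduct`.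

For finitely many frequencies `ξ + 2πk`, distinct modulo `(M₀ᵀ)ⁿ ℤᵈ` once `n` is large, the block
row estimate passes to the limit `n → ∞` (`euclSq_sum_psiHatZero_le`). By duality
`∑ₖ |y* ψ̂⁰(ξ + 2πk)|² ≤ C |y|²` for all vectors `y`, which is the bound on the bracket product.

In the high-pass sum `ψ̂⁰` is evaluated on translates of the lattice `2πAℤᵈ`,
`A = M₀⁻ᵀ M_l⁻ᵀ M₀ᵀ`. As `A` is an invertible rational matrix, this lattice meets only finitely many
classes modulo `2πℤᵈ`, so the sum is controlled by finitely many traces of the bracket product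
(`tsum_mulVec_shift_le`); the factor `b̂_l` is bounded.
-/

noncomputable section

namespace MixedFramelet

/-! ### Exponential sums and the transition operator -/

/-- The exponential `exp(i k·η)`, as a function of the integer vector `k`. -/
def phase {d : ℕ} (k : Fin d → ℤ) (η : Fin d → ℝ) : ℂ :=
  Complex.exp (Complex.I * ((∑ i, (k i : ℝ) * η i : ℝ) : ℂ))

theorem phase_add {d : ℕ} (k l : Fin d → ℤ) (η : Fin d → ℝ) :
    phase (k + l) η = phase k η * phase l η := by
  simp only [phase, ← Complex.exp_add, ← mul_add, ← Complex.ofReal_add, ← Finset.sum_add_distrib]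
  congr 4
  ext i
  push_cast [Pi.add_apply]
  ring

theorem phase_add_right {d : ℕ} (k : Fin d → ℤ) (η ζ : Fin d → ℝ) :
    phase k (η + ζ) = phase k η * phase k ζ := by
  simp only [phase, ← Complex.exp_add, ← mul_add, ← Complex.ofReal_add, ← Finset.sum_add_distrib,
    Pi.add_apply]

theorem norm_phase {d : ℕ} (k : Fin d → ℤ) (η : Fin d → ℝ) : ‖phase k η‖ = 1 := by
  rw [phase, mul_comm]
  exact Complex.norm_exp_ofReal_mul_I _

theorem star_phase {d : ℕ} (k : Fin d → ℤ) (η : Fin d → ℝ) :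
    star (phase k η) = phase k (-η) := by
  simp only [phase, Complex.star_def, ← Complex.exp_conj, map_mul, Complex.conj_I,
    Complex.conj_ofReal, Pi.neg_apply, mul_neg, Finset.sum_neg_distrib, Complex.ofReal_neg, neg_mul]

theorem phase_two_pi {d : ℕ} (k l : Fin d → ℤ) :
    phase k (fun i => 2 * Real.pi * (l i : ℝ)) = 1 := by
  rw [phase, Complex.exp_eq_one_iff]
  refine ⟨∑ i, k i * l i, ?_⟩
  push_cast
  rw [Finset.mul_sum, Finset.sum_mul]
  refine Finset.sum_congr rfl fun i _ => ?_
  ring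

theorem phase_mulVec {d : ℕ} (M : Matrix (Fin d) (Fin d) ℤ) (m : Fin d → ℤ) (η : Fin d → ℝ) :
    phase (M *ᵥ m) η = phase m (transR M *ᵥ η) := by
  have : (∑ i, ((M *ᵥ m) i : ℝ) * η i) = ∑ i, (m i : ℝ) * (transR M *ᵥ η) i := by
    have h : (fun i => ((M *ᵥ m) i : ℝ)) = (M.map (Int.cast : ℤ → ℝ)) *ᵥ (fun i => (m i : ℝ)) := by
      ext i
      simp [Matrix.mulVec, dotProduct]
    change (fun i => ((M *ᵥ m) i : ℝ)) ⬝ᵥ η = (fun i => (m i : ℝ)) ⬝ᵥ (transR M *ᵥ η)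
    rw [h, transR, Matrix.mulVec_transpose, dotProduct_comm, Matrix.dotProduct_mulVec,
      dotProduct_comm]
  rw [phase, phase, this]

/-- The row-vector-valued sequence `k ↦ ∑ⱼ exp(i k·ηⱼ) xⱼ*`, for column vectors `xⱼ`. -/
def expSum {d r : ℕ} {κ : Type} [Fintype κ] (η : κ → Fin d → ℝ) (x : κ → Fin r → ℂ) :
    (Fin d → ℤ) → Fin r → ℂ :=
  fun k => ∑ j, phase k (η j) • star (x j)

theorem transition_eq_sum {d r t : ℕ} (b : FinFilter d (Matrix (Fin t) (Fin r) ℂ))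
    (M : Matrix (Fin d) (Fin d) ℤ) (v : (Fin d → ℤ) → Fin r → ℂ) (n : Fin d → ℤ) :
    transition b M v n = ((Real.sqrt |(M.det : ℝ)| : ℝ) : ℂ) •
      ∑ k ∈ b.support, v (k + M *ᵥ n) ᵥ* (b k)ᴴ := by
  rw [transition, ← finsum_comp_equiv (Equiv.addRight (M *ᵥ n))]
  congr 1
  simp only [Equiv.coe_addRight, add_sub_cancel_right]
  refine finsum_eq_sum_of_support_subset _ fun k hk => ?_
  contrapose! hk
  have : b k = 0 := by simpa using hk
  simp [this]

/-- The transition operator acts on exponentials by multiplication with the adjoint of the symbol, and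
transports the frequency `η` to `Mᵀ η`. -/
theorem transition_expSum {d r t : ℕ} {κ : Type} [Fintype κ]
    (b : FinFilter d (Matrix (Fin t) (Fin r) ℂ)) (M : Matrix (Fin d) (Fin d) ℤ)
    (η : κ → Fin d → ℝ) (x : κ → Fin r → ℂ) :
    transition b M (expSum η x) = expSum (fun j => transR M *ᵥ η j)
      (fun j => ((Real.sqrt |(M.det : ℝ)| : ℝ) : ℂ) • (fourierSeries b (η j) *ᵥ x j)) := by
  funext n
  have h : ∀ j, star (fourierSeries b (η j) *ᵥ x j)
      = ∑ k ∈ b.support, phase k (η j) • (star (x j) ᵥ* (b k)ᴴ) := by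
    intro j
    rw [fourierSeries, Finsupp.sum, Matrix.sum_mulVec, star_sum]
    refine Finset.sum_congr rfl fun k _ => ?_
    rw [Matrix.smul_mulVec, star_smul, Matrix.star_mulVec]
    congr 1
    rw [phase, Complex.star_def, ← Complex.exp_conj]
    simp
  rw [transition_eq_sum, expSum]
  simp only [star_smul, Complex.star_def, Complex.conj_ofReal, h, expSum]
  rw [Finset.smul_sum]
  simp only [Matrix.sum_vecMul, Finset.smul_sum, Matrix.smul_vecMul]
  rw [Finset.sum_comm]
  refine Finset.sum_congr rfl fun j _ => Finset.sum_congr rfl fun k _ => ?_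
  rw [phase_add, phase_mulVec, smul_smul, smul_smul, smul_smul]
  ring_nf

/-- The matrix product `b̂₀(M₀⁻ᵀ ξ) ⋯ b̂₀((M₀⁻ᵀ)ⁿ ξ)`. -/
def cascade {d r : ℕ} (M₀ : Matrix (Fin d) (Fin d) ℤ)
    (b₀ : FinFilter d (Matrix (Fin r) (Fin r) ℂ)) (n : ℕ) (ξ : Fin d → ℝ) :
    Matrix (Fin r) (Fin r) ℂ :=
  ((List.range n).map fun j => fourierSeries b₀ ((invTransR M₀ ^ (j + 1)) *ᵥ ξ)).prod

theorem cascade_succ {d r : ℕ} (M₀ : Matrix (Fin d) (Fin d) ℤ)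
    (b₀ : FinFilter d (Matrix (Fin r) (Fin r) ℂ)) (n : ℕ) (ξ : Fin d → ℝ) :
    cascade M₀ b₀ (n + 1) ξ
      = cascade M₀ b₀ n ξ * fourierSeries b₀ ((invTransR M₀ ^ (n + 1)) *ᵥ ξ) := by
  simp [cascade, List.range_succ]

theorem cascade_succ' {d r : ℕ} (M₀ : Matrix (Fin d) (Fin d) ℤ)
    (b₀ : FinFilter d (Matrix (Fin r) (Fin r) ℂ)) (n : ℕ) (ξ : Fin d → ℝ) :
    cascade M₀ b₀ (n + 1) ξ
      = fourierSeries b₀ (invTransR M₀ *ᵥ ξ) * cascade M₀ b₀ n (invTransR M₀ *ᵥ ξ) := by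
  simp [cascade, List.range_succ_eq_map, Function.comp_def, Matrix.mulVec_mulVec, ← pow_succ]

theorem transR_mul_invTransR {d : ℕ} {M : Matrix (Fin d) (Fin d) ℤ} (hM : M.det ≠ 0) :
    transR M * invTransR M = 1 := by
  rw [invTransR]
  refine Matrix.mul_nonsing_inv _ ?_
  rw [transR, Matrix.det_transpose, isUnit_iff_ne_zero]
  have : (M.map (Int.cast : ℤ → ℝ)).det = (M.det : ℝ) := (Int.castRingHom ℝ).map_det M |>.symm
  rw [this]
  exact_mod_cast hM

theorem lowPass_expSum {d r : ℕ} {κ : Type} [Fintype κ] {M₀ : Matrix (Fin d) (Fin d) ℤ}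
    (hM : M₀.det ≠ 0) (b₀ : FinFilter d (Matrix (Fin r) (Fin r) ℂ)) (n : ℕ)
    (ζ : κ → Fin d → ℝ) (x : κ → Fin r → ℂ) :
    lowPass M₀ b₀ (expSum (fun j => (invTransR M₀ ^ n) *ᵥ ζ j) x) n
      = expSum ζ (fun j => ((Real.sqrt |(M₀.det : ℝ)| ^ n : ℝ) : ℂ) •
          (cascade M₀ b₀ n (ζ j) *ᵥ x j)) := by
  induction n generalizing ζ with
  | zero => simp [lowPass, cascade]
  | succ n ih =>
    have h : (fun j => (invTransR M₀ ^ (n + 1)) *ᵥ ζ j)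
        = fun j => (invTransR M₀ ^ n) *ᵥ (invTransR M₀ *ᵥ ζ j) := by
      funext j
      rw [Matrix.mulVec_mulVec, pow_succ]
    rw [lowPass, h, ih, transition_expSum]
    simp only [Matrix.mulVec_mulVec, transR_mul_invTransR hM, Matrix.one_mulVec]
    congr 1
    funext j
    rw [cascade_succ', Matrix.mulVec_smul, smul_smul, Matrix.mulVec_mulVec]
    push_cast
    rw [pow_succ']

/-- The value of the iterated transition operator at `m` depends only on a finite window of the
sequence, positioned at `M₀ⁿ m`. -/
theorem exists_lowPass_window {d r : ℕ} (M₀ : Matrix (Fin d) (Fin d) ℤ)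
    (b₀ : FinFilter d (Matrix (Fin r) (Fin r) ℂ)) (n : ℕ) :
    ∃ F : Finset (Fin d → ℤ), ∀ (v w : (Fin d → ℤ) → Fin r → ℂ) (m : Fin d → ℤ),
      (∀ f ∈ F, v ((M₀ ^ n) *ᵥ m + f) = w ((M₀ ^ n) *ᵥ m + f)) →
        lowPass M₀ b₀ v n m = lowPass M₀ b₀ w n m := by
  classical
  induction n with
  | zero => exact ⟨{0}, fun v w m h => by simpa [lowPass] using h⟩
  | succ n ih =>
    obtain ⟨F, hF⟩ := ih
    refine ⟨Finset.image₂ (fun k f => (M₀ ^ n) *ᵥ k + f) b₀.support F, fun v w m h => ?_⟩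
    rw [lowPass, lowPass, transition_eq_sum, transition_eq_sum]
    congr 1
    refine Finset.sum_congr rfl fun k hk => ?_
    rw [hF v w (k + M₀ *ᵥ m) fun f hf => ?_]
    have := h ((M₀ ^ n) *ᵥ k + f) (Finset.mem_image₂_of_mem hk hf)
    have e : (M₀ ^ n) *ᵥ (k + M₀ *ᵥ m) + f = (M₀ ^ (n + 1)) *ᵥ m + ((M₀ ^ n) *ᵥ k + f) := by
      rw [Matrix.mulVec_add, Matrix.mulVec_mulVec, ← pow_succ]
      abel
    rwa [e]

/-! ### Orthogonality of characters on the quotient by a lattice -/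

theorem card_quotient_range_mulVecLin {d : ℕ} {N : Matrix (Fin d) (Fin d) ℤ} (hN : N.det ≠ 0) :
    Nat.card ((Fin d → ℤ) ⧸ LinearMap.range N.mulVecLin) = N.det.natAbs := by
  have hinj : Function.Injective N.mulVecLin := Matrix.mulVec_injective_of_det_ne_zero hN
  rw [← Submodule.natAbs_det_equiv (LinearMap.range N.mulVecLin)
    (LinearEquiv.ofInjective N.mulVecLin hinj)]
  have : (LinearMap.range N.mulVecLin).subtype ∘ₗ AddMonoidHom.toIntLinearMap
      ((LinearEquiv.ofInjective N.mulVecLin hinj : (Fin d → ℤ) ≃ₗ[ℤ] _) :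
        (Fin d → ℤ) →+ LinearMap.range N.mulVecLin) = Matrix.toLin' N := by
    ext; rfl
  rw [this, LinearMap.det_toLin']

theorem finite_quotient_range_mulVecLin {d : ℕ} {N : Matrix (Fin d) (Fin d) ℤ} (hN : N.det ≠ 0) :
    Finite ((Fin d → ℤ) ⧸ LinearMap.range N.mulVecLin) :=
  Nat.finite_of_card_ne_zero (by rw [card_quotient_range_mulVecLin hN]; simpa using hN)

theorem exists_eq_mulVec_add_out {d : ℕ} (N : Matrix (Fin d) (Fin d) ℤ) (k : Fin d → ℤ) :
    ∃ m, k = N *ᵥ m +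
      Quotient.out (Submodule.Quotient.mk k : (Fin d → ℤ) ⧸ LinearMap.range N.mulVecLin) := by
  have h : (Submodule.Quotient.mk (Quotient.out (Submodule.Quotient.mk k :
      (Fin d → ℤ) ⧸ LinearMap.range N.mulVecLin)) : (Fin d → ℤ) ⧸ LinearMap.range N.mulVecLin)
      = Submodule.Quotient.mk k := Quotient.out_eq _
  obtain ⟨m, hm⟩ := (Submodule.Quotient.eq _).1 h.symm
  exact ⟨m, by rw [← Matrix.mulVecLin_apply, hm]; abel⟩

/-- A nontrivial character of `ℤᵈ` that is trivial on `N ℤᵈ` sums to zero over representatives of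
`ℤᵈ / N ℤᵈ`. -/
theorem sum_phase_out_eq_zero {d : ℕ} (N : Matrix (Fin d) (Fin d) ℤ)
    [Fintype ((Fin d → ℤ) ⧸ LinearMap.range N.mulVecLin)] (η : Fin d → ℝ)
    (hη : ∀ m, phase (N *ᵥ m) η = 1) {k₀ : Fin d → ℤ} (hk₀ : phase k₀ η ≠ 1) :
    ∑ q : (Fin d → ℤ) ⧸ LinearMap.range N.mulVecLin, phase (Quotient.out q) η = 0 := by
  have hmk : ∀ k, phase (Quotient.out (Submodule.Quotient.mk k :
      (Fin d → ℤ) ⧸ LinearMap.range N.mulVecLin)) η = phase k η := by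
    intro k
    obtain ⟨m, hm⟩ := exists_eq_mulVec_add_out N k
    conv_rhs => rw [hm, phase_add, hη, one_mul]
  have hshift : ∀ q : (Fin d → ℤ) ⧸ LinearMap.range N.mulVecLin,
      phase (Quotient.out (Submodule.Quotient.mk k₀ + q)) η
        = phase k₀ η * phase (Quotient.out q) η := by
    intro q
    obtain ⟨k, rfl⟩ := Submodule.Quotient.mk_surjective _ q
    rw [← Submodule.Quotient.mk_add, hmk, hmk, phase_add]
  have h := Equiv.sum_comp (Equiv.addLeft (Submodule.Quotient.mk k₀ :
    (Fin d → ℤ) ⧸ LinearMap.range N.mulVecLin)) (fun q => phase (Quotient.out q) η)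
  simp only [Equiv.coe_addLeft, hshift, ← Finset.mul_sum] at h
  by_contra hne
  exact hk₀ ((mul_eq_right₀ hne).1 h)

/-- The squared Euclidean length `∑ᵢ |xᵢ|²`; the norm `‖x‖` of a function on `ι` is the supremum
norm. -/
def euclSq {ι : Type} [Fintype ι] (x : ι → ℂ) : ℝ := ∑ i, ‖x i‖ ^ 2

theorem euclSq_nonneg {ι : Type} [Fintype ι] (x : ι → ℂ) : 0 ≤ euclSq x :=
  Finset.sum_nonneg fun _ _ => sq_nonneg _

theorem euclSq_star {ι : Type} [Fintype ι] (x : ι → ℂ) : euclSq (star x) = euclSq x := by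
  simp [euclSq]

theorem euclSq_smul {ι : Type} [Fintype ι] (c : ℂ) (x : ι → ℂ) :
    euclSq (c • x) = ‖c‖ ^ 2 * euclSq x := by
  simp [euclSq, mul_pow, Finset.mul_sum]

theorem ofReal_euclSq {ι : Type} [Fintype ι] (x : ι → ℂ) : (euclSq x : ℂ) = x ⬝ᵥ star x := by
  simp [euclSq, dotProduct, Complex.mul_conj']

theorem sum_enorm_sq {ι : Type} [Fintype ι] (x : ι → ℂ) :
    ∑ i, ‖x i‖ₑ ^ 2 = ENNReal.ofReal (euclSq x) := by
  rw [euclSq, ENNReal.ofReal_sum_of_nonneg fun _ _ => sq_nonneg _]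
  refine Finset.sum_congr rfl fun i _ => ?_
  rw [ENNReal.ofReal_pow (norm_nonneg _), ofReal_norm]

/-- Parseval's identity on `ℤᵈ / N ℤᵈ` for an exponential sum with frequencies that differ by
characters of this group, pairwise distinct. -/
theorem sum_euclSq_expSum {d r : ℕ} {κ : Type} [Fintype κ] (N : Matrix (Fin d) (Fin d) ℤ)
    [Fintype ((Fin d → ℤ) ⧸ LinearMap.range N.mulVecLin)] (η : κ → Fin d → ℝ)
    (x : κ → Fin r → ℂ) (hη : ∀ j j' m, phase (N *ᵥ m) (η j - η j') = 1)
    (hne : ∀ j j', j ≠ j' → ∃ k, phase k (η j - η j') ≠ 1) :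
    ∑ q : (Fin d → ℤ) ⧸ LinearMap.range N.mulVecLin, euclSq (expSum η x (Quotient.out q))
      = Fintype.card ((Fin d → ℤ) ⧸ LinearMap.range N.mulVecLin) * ∑ j, euclSq (x j) := by
  classical
  rw [← Complex.ofReal_inj]
  push_cast
  have h : ∀ k, (euclSq (expSum η x k) : ℂ)
      = ∑ j, ∑ j', phase k (η j - η j') * (star (x j) ⬝ᵥ x j') := by
    intro k
    simp only [ofReal_euclSq, expSum, star_sum, sum_dotProduct, dotProduct_sum, star_smul,
      star_star, smul_dotProduct, dotProduct_smul, smul_eq_mul, star_phase, Finset.mul_sum]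
    rw [Finset.sum_comm]
    refine Finset.sum_congr rfl fun j _ => Finset.sum_congr rfl fun j' _ => ?_
    rw [sub_eq_add_neg, phase_add_right]
    ring
  simp only [h]
  rw [Finset.sum_comm, Finset.mul_sum]
  refine Finset.sum_congr rfl fun j _ => ?_
  rw [Finset.sum_comm, Finset.sum_eq_single j]
  · simp [phase, ofReal_euclSq, dotProduct_comm]
  · intro j' _ hj
    obtain ⟨k, hk⟩ := hne j j' hj.symm
    rw [← Finset.sum_mul, sum_phase_out_eq_zero N _ (hη j j') hk, zero_mul]
  · simp

/-! ### Stability bounds the fibers of the cascade products -/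

theorem transR_mul {d : ℕ} (M N : Matrix (Fin d) (Fin d) ℤ) :
    transR (M * N) = transR N * transR M := by
  have : (M * N).map (Int.cast : ℤ → ℝ) = M.map Int.cast * N.map Int.cast :=
    Matrix.map_mul (f := Int.castRingHom ℝ)
  rw [transR, this, Matrix.transpose_mul, transR, transR]

theorem transR_pow {d : ℕ} (M : Matrix (Fin d) (Fin d) ℤ) (n : ℕ) :
    transR (M ^ n) = transR M ^ n := by
  induction n with
  | zero =>
    rw [pow_zero, pow_zero, transR]
    simp
  | succ n ih => rw [pow_succ', transR_mul, ih, pow_succ]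

theorem transR_pow_mul_invTransR_pow {d : ℕ} {M : Matrix (Fin d) (Fin d) ℤ} (hM : M.det ≠ 0)
    (n : ℕ) : transR M ^ n * invTransR M ^ n = 1 := by
  have h := transR_mul_invTransR hM
  have hc : Commute (transR M) (invTransR M) := by
    rw [Commute, SemiconjBy, h, mul_eq_one_comm.1 h]
  rw [← hc.mul_pow, h, one_pow]

theorem exists_phase_ne_one {d : ℕ} {η : Fin d → ℝ}
    (h : ∀ l : Fin d → ℤ, η ≠ fun i => 2 * Real.pi * (l i : ℝ)) : ∃ k, phase k η ≠ 1 := by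
  classical
  by_contra! hk
  have : ∀ i, ∃ l : ℤ, η i = 2 * Real.pi * l := by
    intro i
    have := hk (Pi.single i 1)
    rw [phase, Complex.exp_eq_one_iff] at this
    obtain ⟨l, hl⟩ := this
    refine ⟨l, ?_⟩
    rw [Finset.sum_eq_single i (by intro j _ hj; simp [hj]) (by simp)] at hl
    have h2 : Complex.I * ((η i : ℂ) - 2 * Real.pi * l) = 0 := by
      rw [mul_sub]
      simp only [Pi.single_eq_same, Int.cast_one, one_mul] at hl
      rw [hl]
      ring
    have h3 := (mul_eq_zero.1 h2).resolve_left Complex.I_ne_zero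
    rw [sub_eq_zero] at h3
    exact_mod_cast h3
  choose l hl using this
  exact h l (funext hl)

theorem sqNorm_lowPass_le {d r s : ℕ} (M₀ : Matrix (Fin d) (Fin d) ℤ)
    (M : Fin s → Matrix (Fin d) (Fin d) ℤ) (b₀ : FinFilter d (Matrix (Fin r) (Fin r) ℂ))
    (b : Fin s → FinFilter d (Matrix (Fin 1) (Fin r) ℂ)) (J : ℕ)
    (v : (Fin d → ℤ) → Fin r → ℂ) :
    sqNorm (lowPass M₀ b₀ v J) ≤ sqNorm (analysis M₀ M b₀ b J v) := by
  refine ENNReal.tsum_le_tsum fun k => ?_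
  rw [Fintype.sum_sum_type]
  exact le_add_left le_rfl

theorem sqNorm_eq_tsum {d : ℕ} {ι : Type} [Fintype ι] (v : (Fin d → ℤ) → ι → ℂ) :
    sqNorm v = ∑' k, ENNReal.ofReal (euclSq (v k)) := by
  simp only [sqNorm, sum_enorm_sq]

/-- Boxes of side `2 R + 1` and `2 (R + L) + 1` have asymptotically the same volume. -/
theorem le_of_forall_box_le {d : ℕ} {L : ℕ} {A B : ℝ}
    (h : ∀ R : ℕ, (2 * R + 1 : ℝ) ^ d * A ≤ (2 * (R + L) + 1 : ℝ) ^ d * B) : A ≤ B := by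
  have h1 : Tendsto (fun R : ℕ => (2 * L : ℝ) / (2 * R + 1)) atTop (𝓝 0) := by
    refine Tendsto.div_atTop tendsto_const_nhds ?_
    exact tendsto_atTop_add_const_right _ _
      (tendsto_natCast_atTop_atTop.const_mul_atTop (by norm_num))
  have h2 : Tendsto (fun R : ℕ => (1 + (2 * L : ℝ) / (2 * R + 1)) ^ d * B) atTop (𝓝 B) := by
    simpa using ((h1.const_add 1).pow d).mul_const B
  refine ge_of_tendsto' h2 fun R => ?_
  have hR : (0 : ℝ) < 2 * R + 1 := by positivity
  have e : (1 + (2 * L : ℝ) / (2 * R + 1)) = (2 * (R + L) + 1) / (2 * R + 1) := by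
    field_simp
    ring
  rw [e, div_pow, div_mul_eq_mul_div, le_div_iff₀ (by positivity), mul_comm A]
  exact h R

theorem card_box (d R : ℕ) :
    (Finset.Icc (fun _ : Fin d => -(R : ℤ)) (fun _ => (R : ℤ))).card = (2 * R + 1) ^ d := by
  rw [Pi.card_Icc]
  simp only [Int.card_Icc, Finset.prod_const, Finset.card_univ, Fintype.card_fin]
  congr 1
  omega

theorem shift_eq_add {d : ℕ} (ξ : Fin d → ℝ) (k : Fin d → ℤ) :
    shift ξ k = ξ + fun i => 2 * Real.pi * (k i : ℝ) := rfl

theorem phase_shift {d : ℕ} (m k : Fin d → ℤ) (ξ : Fin d → ℝ) :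
    phase m (shift ξ k) = phase m ξ := by
  rw [shift_eq_add, phase_add_right, phase_two_pi, mul_one]

/-- If the low-pass analysis operator of level `n` is bounded on `ℓ₂`, then so are the fibers of
its symbol: frequencies `ξ + 2πkⱼ` with `kⱼ` distinct modulo `(M₀ᵀ)ⁿ ℤᵈ` give a row
`(cascade n (ξ + 2πkⱼ))ⱼ` of norm at most `√C`. The operator is tested on an exponential sum cut
off to a large union of cosets of `M₀ⁿ ℤᵈ`. -/
theorem euclSq_sum_cascade_le {d r : ℕ} {κ : Type} [Fintype κ] {M₀ : Matrix (Fin d) (Fin d) ℤ}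
    (hM : M₀.det ≠ 0) {b₀ : FinFilter d (Matrix (Fin r) (Fin r) ℂ)} {C : ℝ} (hC : 0 ≤ C) {n : ℕ}
    (hb : ∀ v : (Fin d → ℤ) → Fin r → ℂ, sqNorm v < ∞ →
      sqNorm (lowPass M₀ b₀ v n) ≤ ENNReal.ofReal C * sqNorm v)
    (ξ : Fin d → ℝ) (k : κ → Fin d → ℤ)
    (hk : ∀ j j', j ≠ j' → ∀ l : Fin d → ℤ, k j - k j' ≠ (M₀ ^ n)ᵀ *ᵥ l)
    (x : κ → Fin r → ℂ) :
    euclSq (∑ j, cascade M₀ b₀ n (shift ξ (k j)) *ᵥ x j) ≤ C * ∑ j, euclSq (x j) := by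
  classical
  have hN : (M₀ ^ n).det ≠ 0 := by rw [Matrix.det_pow]; exact pow_ne_zero _ hM
  set N := M₀ ^ n with hNdef
  have hinv : transR N * invTransR M₀ ^ n = 1 := by
    rw [hNdef, transR_pow, transR_pow_mul_invTransR_pow hM]
  have := finite_quotient_range_mulVecLin hN
  have := Fintype.ofFinite ((Fin d → ℤ) ⧸ LinearMap.range N.mulVecLin)
  set Q := (Fin d → ℤ) ⧸ LinearMap.range N.mulVecLin with hQ
  set ζ : κ → Fin d → ℝ := fun j => shift ξ (k j) with hζ
  set η : κ → Fin d → ℝ := fun j => (invTransR M₀ ^ n) *ᵥ ζ j with hη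
  have htη : ∀ j, transR N *ᵥ η j = ζ j := fun j => by
    rw [hη, Matrix.mulVec_mulVec, hinv, Matrix.one_mulVec]
  set V := expSum η x with hV
  -- up to a unimodular factor, `V` is periodic with respect to `N ℤᵈ`
  have hper : ∀ m l, V (N *ᵥ m + l) = phase m ξ • V l := by
    intro m l
    simp only [hV, expSum, phase_add, phase_mulVec, htη, hζ, phase_shift, Finset.smul_sum, mul_smul]
  have hlow : ∀ m, euclSq (lowPass M₀ b₀ V n m)
      = |(N.det : ℝ)| * euclSq (∑ j, cascade M₀ b₀ n (ζ j) *ᵥ x j) := by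
    intro m
    rw [hV, hη, lowPass_expSum hM]
    have : expSum ζ (fun j => ((Real.sqrt |(M₀.det : ℝ)| ^ n : ℝ) : ℂ) •
          (cascade M₀ b₀ n (ζ j) *ᵥ x j)) m = (phase m ξ * ((Real.sqrt |(M₀.det : ℝ)| ^ n : ℝ) : ℂ)) •
          star (∑ j, cascade M₀ b₀ n (ζ j) *ᵥ x j) := by
      simp only [expSum, hζ, phase_shift, star_smul, Complex.star_def, Complex.conj_ofReal,
        mul_smul, star_sum, Finset.smul_sum]
    rw [this, euclSq_smul, euclSq_star, norm_mul, norm_phase, one_mul, Complex.norm_real,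
      Real.norm_of_nonneg (by positivity), ← pow_mul, mul_comm n 2, pow_mul,
      Real.sq_sqrt (abs_nonneg _), hNdef, Matrix.det_pow]
    push_cast
    rw [abs_pow]
  have hpars : ∑ q : Q, euclSq (V (Quotient.out q)) = |(N.det : ℝ)| * ∑ j, euclSq (x j) := by
    rw [hV, sum_euclSq_expSum]
    · rw [← Nat.card_eq_fintype_card, card_quotient_range_mulVecLin hN, Nat.cast_natAbs,
        Int.cast_abs]
    · intro j j' m
      rw [phase_mulVec, Matrix.mulVec_sub, htη, htη, hζ]
      have : shift ξ (k j) - shift ξ (k j') = fun i => 2 * Real.pi * ((k j - k j') i : ℝ) := by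
        ext i
        simp [shift]
        ring
      rw [this, phase_two_pi]
    · intro j j' hj
      refine exists_phase_ne_one fun l hl => hk j j' hj l ?_
      have h1 := congrArg (transR N *ᵥ ·) hl
      simp only [Matrix.mulVec_sub, htη] at h1
      ext i
      have h2 := congrFun h1 i
      have h3 : (transR N *ᵥ fun i => 2 * Real.pi * (l i : ℝ)) i
          = 2 * Real.pi * ((Nᵀ *ᵥ l) i : ℝ) := by
        simp only [transR, Matrix.mulVec, dotProduct, Matrix.transpose_apply, Matrix.map_apply,
          Int.cast_sum, Int.cast_mul, Finset.mul_sum]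
        refine Finset.sum_congr rfl fun a _ => ?_
        ring
      rw [h3] at h2
      have h4 : 2 * Real.pi * ((k j i : ℝ) - k j' i) = 2 * Real.pi * ((Nᵀ *ᵥ l) i : ℝ) := by
        rw [← h2]
        simp [hζ, shift]
        ring
      have h5 := mul_left_cancel₀ (by positivity) h4
      rw [Pi.sub_apply]
      exact_mod_cast h5
  obtain ⟨F, hF⟩ := exists_lowPass_window M₀ b₀ n
  choose μ hμ using exists_eq_mulVec_add_out N
  -- cutting `V` off outside a box enlarged by `L` does not change the output on the box itself
  obtain ⟨L, hL⟩ : ∃ L : ℕ, ∀ f ∈ F, ∀ i, |μ f i| ≤ L := by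
    refine ⟨F.sup fun f => Finset.univ.sup fun i => (μ f i).natAbs, fun f hf i => ?_⟩
    rw [Int.abs_eq_natAbs]
    have h1 := Finset.le_sup (f := fun i => (μ f i).natAbs) (Finset.mem_univ i)
    have h2 := Finset.le_sup (f := fun f => Finset.univ.sup fun i => (μ f i).natAbs) hf
    exact_mod_cast h1.trans h2
  have hdet : 0 < |(N.det : ℝ)| := abs_pos.2 (by exact_mod_cast hN)
  refine le_of_forall_box_le (d := d) (L := L) fun R => ?_
  set box : ℕ → Finset (Fin d → ℤ) := fun R => Finset.Icc (fun _ => -(R : ℤ)) (fun _ => (R : ℤ))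
    with hbox
  set S : Finset (Fin d → ℤ) := Finset.image₂ (fun m (q : Q) => N *ᵥ m + Quotient.out q)
    (box (R + L)) Finset.univ with hS
  set v : (Fin d → ℤ) → Fin r → ℂ := fun l => if l ∈ S then V l else 0 with hv
  have hvnorm : sqNorm v ≤ ENNReal.ofReal
      ((2 * (R + L) + 1 : ℝ) ^ d * (|(N.det : ℝ)| * ∑ j, euclSq (x j))) := by
    rw [sqNorm_eq_tsum, tsum_eq_sum (s := S) (by intro l hl; simp [hv, hl, euclSq])]
    calc ∑ l ∈ S, ENNReal.ofReal (euclSq (v l))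
        = ENNReal.ofReal (∑ l ∈ S, euclSq (V l)) := by
          rw [ENNReal.ofReal_sum_of_nonneg fun _ _ => euclSq_nonneg _]
          exact Finset.sum_congr rfl fun l hl => by simp [hv, hl]
      _ ≤ ENNReal.ofReal (∑ p ∈ box (R + L) ×ˢ (Finset.univ : Finset Q),
            euclSq (V (N *ᵥ p.1 + Quotient.out p.2))) := by
          refine ENNReal.ofReal_le_ofReal ?_
          exact Finset.sum_image_le_of_nonneg fun _ _ => euclSq_nonneg _
      _ = _ := by
          simp only [hper, euclSq_smul, norm_phase, one_pow, one_mul]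
          rw [Finset.sum_product]
          simp only [hpars, Finset.sum_const, hbox, card_box, nsmul_eq_mul]
          push_cast
          ring_nf
  have hvlow : ∀ m ∈ box R, lowPass M₀ b₀ v n m = lowPass M₀ b₀ V n m := by
    intro m hm
    refine hF v V m fun f hf => ?_
    have : (M₀ ^ n) *ᵥ m + f ∈ S := by
      refine Finset.mem_image₂.2 ⟨m + μ f, ?_, Submodule.Quotient.mk f, Finset.mem_univ _, ?_⟩
      · simp only [hbox, Finset.mem_Icc, Pi.le_def] at hm ⊢
        refine ⟨fun i => ?_, fun i => ?_⟩ <;>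
        · have h1 := hm.1 i
          have h2 := hm.2 i
          have h3 := abs_le.1 (hL f hf i)
          simp only [Pi.add_apply]
          push_cast
          omega
      · rw [Matrix.mulVec_add, add_assoc, ← hμ f]
    simp only [hv, if_pos this]
  have hlower : ENNReal.ofReal ((2 * R + 1 : ℝ) ^ d *
      (|(N.det : ℝ)| * euclSq (∑ j, cascade M₀ b₀ n (ζ j) *ᵥ x j)))
      ≤ sqNorm (lowPass M₀ b₀ v n) := by
    rw [sqNorm_eq_tsum]
    refine le_trans (le_of_eq ?_) (ENNReal.sum_le_tsum (box R))
    rw [← ENNReal.ofReal_sum_of_nonneg fun _ _ => euclSq_nonneg _]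
    congr 1
    have : ∀ m ∈ box R, euclSq (lowPass M₀ b₀ v n m)
        = |(N.det : ℝ)| * euclSq (∑ j, cascade M₀ b₀ n (ζ j) *ᵥ x j) :=
      fun m hm => by rw [hvlow m hm, hlow m]
    rw [Finset.sum_congr rfl this]
    simp [hbox, card_box]
  have hx : 0 ≤ ∑ j, euclSq (x j) := Finset.sum_nonneg fun _ _ => euclSq_nonneg _
  have hfin := hlower.trans ((hb v (hvnorm.trans_lt ENNReal.ofReal_lt_top)).trans
    (mul_le_mul_right hvnorm _))
  rw [← ENNReal.ofReal_mul hC, ENNReal.ofReal_le_ofReal_iff (by positivity)] at hfin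
  refine le_of_mul_le_mul_left ?_ hdet
  calc _ = _ := by ring
    _ ≤ _ := hfin
    _ = _ := by ring

/-! ### Dilation matrices -/

theorem IsDilation.one_lt_norm_of_mem_spectrum {d : ℕ} {M : Matrix (Fin d) (Fin d) ℤ}
    (hM : IsDilation M) {μ : ℂ} (hμ : μ ∈ spectrum ℂ (M.map (Int.cast : ℤ → ℂ))) : 1 < ‖μ‖ :=
  hM μ (Module.End.hasEigenvalue_iff_mem_spectrum.2 (by rwa [Matrix.spectrum_toLin']))

theorem IsDilation.det_ne_zero {d : ℕ} {M : Matrix (Fin d) (Fin d) ℤ}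
    (hM : IsDilation M) : M.det ≠ 0 := by
  intro h
  have h0 : (0 : ℂ) ∈ spectrum ℂ (M.map (Int.cast : ℤ → ℂ)) := by
    rw [spectrum.zero_mem_iff, Matrix.isUnit_iff_isUnit_det]
    have : (M.map (Int.cast : ℤ → ℂ)).det = (M.det : ℂ) := ((Int.castRingHom ℂ).map_det M).symm
    rw [this, h]
    simp
  have := hM.one_lt_norm_of_mem_spectrum h0
  simp at this
  linarith

/-- The powers of `M⁻ᵀ` decay geometrically, by Gelfand's formula for the spectral radius. -/
theorem IsDilation.exists_norm_invTransR_pow_le {d : ℕ} {M : Matrix (Fin d) (Fin d) ℤ}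
    (hM : IsDilation M) :
    ∃ q : ℝ, 0 ≤ q ∧ q < 1 ∧ ∀ᶠ n in atTop, ∀ ξ : Fin d → ℝ,
      ‖(invTransR M ^ n) *ᵥ ξ‖ ≤ q ^ n * ‖ξ‖ := by
  rcases isEmpty_or_nonempty (Fin d) with hd | hd
  · exact ⟨0, le_rfl, one_pos, Eventually.of_forall fun n ξ => by
      rw [Subsingleton.elim ((invTransR M ^ n) *ᵥ ξ) 0, norm_zero]
      positivity⟩
  let _ : NormedRing (Matrix (Fin d) (Fin d) ℂ) := Matrix.linftyOpNormedRing
  let _ : NormedAlgebra ℂ (Matrix (Fin d) (Fin d) ℂ) := Matrix.linftyOpNormedAlgebra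
  have : CompleteSpace (Matrix (Fin d) (Fin d) ℂ) := FiniteDimensional.complete ℂ _
  set A : Matrix (Fin d) (Fin d) ℂ := M.map (Int.cast : ℤ → ℂ) with hA
  set X : Matrix (Fin d) (Fin d) ℂ := (invTransR M).map Complex.ofRealHom with hX
  have hAX : Aᵀ * X = 1 := by
    have h := congrArg (fun B : Matrix (Fin d) (Fin d) ℝ => B.map Complex.ofRealHom)
      (transR_mul_invTransR hM.det_ne_zero)
    simp only [Matrix.map_mul] at h
    rw [Matrix.map_one _ (map_zero _) (map_one _)] at h
    rw [← h, hX, hA]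
    congr 1
  have hspec : ∀ z ∈ spectrum ℂ X, ‖z‖₊ < 1 := by
    intro z hz
    let w : (Matrix (Fin d) (Fin d) ℂ)ˣ := ⟨X, Aᵀ, mul_eq_one_comm.1 hAX, hAX⟩
    have hz0 : z ≠ 0 := spectrum.ne_zero_of_mem_of_unit (a := w) hz
    have h1 : z⁻¹ ∈ spectrum ℂ Aᵀ := (spectrum.inv_mem_iff (r := Units.mk0 z hz0) (a := w)).1 hz
    have h2 : z⁻¹ ∈ spectrum ℂ A := by
      rw [spectrum.mem_iff] at h1 ⊢
      rwa [← Matrix.isUnit_transpose, Matrix.transpose_sub, Matrix.algebraMap_eq_diagonal,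
        Matrix.diagonal_transpose, ← Matrix.algebraMap_eq_diagonal]
    have h3 := hM.one_lt_norm_of_mem_spectrum h2
    rw [norm_inv] at h3
    exact_mod_cast (one_lt_inv₀ (norm_pos_iff.2 hz0)).1 h3
  have hρ : spectralRadius ℂ X < ((1 : NNReal) : ℝ≥0∞) :=
    spectrum.spectralRadius_lt_of_forall_lt X hspec
  obtain ⟨q, hq, hq1⟩ := ENNReal.lt_iff_exists_nnreal_btwn.1 hρ
  refine ⟨q, q.2, by exact_mod_cast hq1, ?_⟩
  filter_upwards [(spectrum.pow_nnnorm_pow_one_div_tendsto_nhds_spectralRadius X).eventually_lt_const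
    hq, eventually_gt_atTop 0] with n hn hn0 ξ
  have hnorm : ‖X ^ n‖ ≤ q ^ n := by
    have h1 : (‖X ^ n‖₊ : ℝ≥0∞) ≤ (q : ℝ≥0∞) ^ (n : ℝ) := by
      rw [one_div] at hn
      exact (ENNReal.rpow_inv_le_iff (by exact_mod_cast hn0)).1 hn.le
    rw [ENNReal.rpow_natCast] at h1
    exact_mod_cast h1
  have hc : ∀ ζ : Fin d → ℝ, ‖fun i => (ζ i : ℂ)‖ = ‖ζ‖ := fun ζ => by simp [Pi.norm_def]
  have he : (fun i => (((invTransR M ^ n) *ᵥ ξ) i : ℂ)) = (X ^ n) *ᵥ fun i => (ξ i : ℂ) := by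
    have h1 : X ^ n = (invTransR M ^ n).map Complex.ofRealHom :=
      (map_pow Complex.ofRealHom.mapMatrix (invTransR M) n).symm
    rw [h1]
    ext i
    simp [Matrix.mulVec, dotProduct]
  rw [← hc, he, ← hc ξ]
  exact (Matrix.linfty_opNorm_mulVec _ _).trans (mul_le_mul_of_nonneg_right hnorm (norm_nonneg _))

/-- Finitely many distinct integer vectors are distinct modulo `(Mᵀ)ⁿ ℤᵈ` once `n` is large. -/
theorem IsDilation.eventually_sub_ne {d : ℕ} {M : Matrix (Fin d) (Fin d) ℤ}
    (hM : IsDilation M) {k k' : Fin d → ℤ} (hk : k ≠ k') :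
    ∀ᶠ n in atTop, ∀ l : Fin d → ℤ, k - k' ≠ (M ^ n)ᵀ *ᵥ l := by
  obtain ⟨q, hq0, hq1, hq⟩ := hM.exists_norm_invTransR_pow_le
  set η : Fin d → ℝ := fun i => ((k - k') i : ℝ)
  have hlim : Tendsto (fun n : ℕ => q ^ n * ‖η‖) atTop (𝓝 0) := by
    simpa using (tendsto_pow_atTop_nhds_zero_of_lt_one hq0 hq1).mul_const ‖η‖
  filter_upwards [hq, hlim.eventually_lt_const one_pos] with n hn hn1 l hl
  have h1 : η = transR M ^ n *ᵥ fun i => (l i : ℝ) := by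
    ext i
    rw [← transR_pow]
    have := congrFun hl i
    simp only [η, this]
    simp [transR, Matrix.mulVec, dotProduct]
  have h2 : (invTransR M ^ n) *ᵥ η = fun i => (l i : ℝ) := by
    rw [h1, Matrix.mulVec_mulVec,
      mul_eq_one_comm.1 (transR_pow_mul_invTransR_pow hM.det_ne_zero n), Matrix.one_mulVec]
  have h3 : l = 0 := by
    ext i
    have h4 := (norm_le_pi_norm (fun i => (l i : ℝ)) i).trans_lt
      ((h2 ▸ hn η).trans_lt hn1)
    rw [Real.norm_eq_abs] at h4
    have h5 : |l i| < 1 := by exact_mod_cast h4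
    exact Int.abs_lt_one_iff.1 h5
  rw [h3, Matrix.mulVec_zero] at hl
  exact hk (sub_eq_zero.1 hl)

/-! ### Convergence of the infinite product -/

theorem norm_sq_le_euclSq {ι : Type} [Fintype ι] (x : ι → ℂ) : ‖x‖ ^ 2 ≤ euclSq x := by
  have h : ‖x‖ ≤ Real.sqrt (euclSq x) := by
    refine (pi_norm_le_iff_of_nonneg (Real.sqrt_nonneg _)).2 fun i => ?_
    refine Real.le_sqrt_of_sq_le ?_
    exact Finset.single_le_sum (f := fun i => ‖x i‖ ^ 2) (fun _ _ => sq_nonneg _)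
      (Finset.mem_univ i)
  calc ‖x‖ ^ 2 ≤ Real.sqrt (euclSq x) ^ 2 := by gcongr
    _ = euclSq x := Real.sq_sqrt (euclSq_nonneg x)

theorem euclSq_le_card_mul_norm_sq {r : ℕ} (x : Fin r → ℂ) : euclSq x ≤ r * ‖x‖ ^ 2 := by
  calc euclSq x ≤ ∑ _i : Fin r, ‖x‖ ^ 2 :=
        Finset.sum_le_sum fun i _ => by gcongr; exact norm_le_pi_norm x i
    _ = r * ‖x‖ ^ 2 := by simp

theorem partialProduct_eq_cascade {d r : ℕ} (M₀ : Matrix (Fin d) (Fin d) ℤ)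
    (b₀ : FinFilter d (Matrix (Fin r) (Fin r) ℂ)) (u : FinFilter d (Fin r → ℂ))
    (n : ℕ) (ξ : Fin d → ℝ) :
    partialProduct M₀ b₀ u n ξ
      = cascade M₀ b₀ n ξ *ᵥ fourierSeries u ((invTransR M₀ ^ n) *ᵥ ξ) := rfl

theorem tendsto_partialProduct {d r : ℕ} {M₀ : Matrix (Fin d) (Fin d) ℤ} (hM : IsDilation M₀)
    {b₀ : FinFilter d (Matrix (Fin r) (Fin r) ℂ)} {u : FinFilter d (Fin r → ℂ)}
    {Cb τ : ℝ} (hτ : 0 < τ) (hCb : 0 ≤ Cb)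
    (hu : ∀ ξ : Fin d → ℝ, (∀ i, ξ i ∈ Set.Icc (-Real.pi) Real.pi) →
      ‖fourierSeries b₀ ξ *ᵥ fourierSeries u ξ - fourierSeries u (transR M₀ *ᵥ ξ)‖
        ≤ Cb * ‖ξ‖ ^ τ)
    {C : ℝ} {ξ : Fin d → ℝ}
    (hC : ∀ n, 1 ≤ n → ∀ x, euclSq (cascade M₀ b₀ n ξ *ᵥ x) ≤ C * euclSq x) :
    Tendsto (fun n => partialProduct M₀ b₀ u n ξ) atTop (𝓝 (psiHatZero M₀ b₀ u ξ)) := by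
  obtain ⟨q, hq0, hq1, hq⟩ := hM.exists_norm_invTransR_pow_le
  refine CauchySeq.tendsto_limUnder (cauchySeq_of_summable_dist ?_)
  set B := Real.sqrt (|C| * r) with hB
  have hbound : ∀ n, 1 ≤ n → ∀ x, ‖cascade M₀ b₀ n ξ *ᵥ x‖ ≤ B * ‖x‖ := by
    intro n hn x
    rw [hB, ← Real.sqrt_sq (norm_nonneg x), ← Real.sqrt_mul (by positivity)]
    refine Real.le_sqrt_of_sq_le ?_
    calc ‖cascade M₀ b₀ n ξ *ᵥ x‖ ^ 2 ≤ euclSq (cascade M₀ b₀ n ξ *ᵥ x) := norm_sq_le_euclSq _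
      _ ≤ C * euclSq x := hC n hn x
      _ ≤ |C| * (r * ‖x‖ ^ 2) :=
        mul_le_mul (le_abs_self C) (euclSq_le_card_mul_norm_sq x) (euclSq_nonneg x) (abs_nonneg C)
      _ = |C| * r * ‖x‖ ^ 2 := by ring
  have hdiff : ∀ n, partialProduct M₀ b₀ u (n + 1) ξ - partialProduct M₀ b₀ u n ξ
      = cascade M₀ b₀ n ξ *ᵥ
        (fourierSeries b₀ ((invTransR M₀ ^ (n + 1)) *ᵥ ξ)
            *ᵥ fourierSeries u ((invTransR M₀ ^ (n + 1)) *ᵥ ξ)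
          - fourierSeries u (transR M₀ *ᵥ ((invTransR M₀ ^ (n + 1)) *ᵥ ξ))) := by
    intro n
    have h : transR M₀ *ᵥ ((invTransR M₀ ^ (n + 1)) *ᵥ ξ) = (invTransR M₀ ^ n) *ᵥ ξ := by
      rw [Matrix.mulVec_mulVec, pow_succ', ← mul_assoc, transR_mul_invTransR hM.det_ne_zero,
        one_mul]
    rw [partialProduct_eq_cascade, partialProduct_eq_cascade, h, cascade_succ, Matrix.mulVec_sub,
      Matrix.mulVec_mulVec]
  have hlim : Tendsto (fun n : ℕ => q ^ (n + 1) * ‖ξ‖) atTop (𝓝 0) := by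
    simpa using ((tendsto_pow_atTop_nhds_zero_of_lt_one hq0 hq1).comp
      (tendsto_add_atTop_nat 1)).mul_const ‖ξ‖
  have hqτ : q ^ τ < 1 := Real.rpow_lt_one hq0 hq1 hτ
  have hsum : Summable fun n : ℕ => B * Cb * ‖ξ‖ ^ τ * q ^ τ * (q ^ τ) ^ n :=
    (summable_geometric_of_lt_one (Real.rpow_nonneg hq0 τ) hqτ).mul_left _
  refine hsum.of_norm_bounded_eventually_nat ?_
  filter_upwards [(tendsto_add_atTop_nat 1).eventually hq,
    hlim.eventually_lt_const Real.pi_pos, eventually_ge_atTop 1] with n h1 h2 hn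
  rw [Real.norm_of_nonneg dist_nonneg, dist_comm, dist_eq_norm, hdiff]
  set η := (invTransR M₀ ^ (n + 1)) *ᵥ ξ with hη
  have hηle : ‖η‖ ≤ q ^ (n + 1) * ‖ξ‖ := h1 ξ
  have hηpi : ∀ i, η i ∈ Set.Icc (-Real.pi) Real.pi := fun i =>
    abs_le.1 ((norm_le_pi_norm η i).trans (hηle.trans h2.le))
  calc _ ≤ B * ‖fourierSeries b₀ η *ᵥ fourierSeries u η - fourierSeries u (transR M₀ *ᵥ η)‖ :=
        hbound n hn _
    _ ≤ B * (Cb * ‖η‖ ^ τ) := by gcongr; exact hu η hηpi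
    _ ≤ B * (Cb * (q ^ (n + 1) * ‖ξ‖) ^ τ) := by gcongr
    _ = _ := by
      rw [Real.mul_rpow (by positivity) (norm_nonneg _), ← Real.rpow_natCast_mul hq0,
        mul_comm ((n + 1 : ℕ) : ℝ) τ, Real.rpow_mul_natCast hq0, pow_succ]
      ring

/-! ### The bracket product -/

theorem norm_fourierSeries_le {d : ℕ} {E : Type} [NormedAddCommGroup E] [NormedSpace ℂ E]
    (a : FinFilter d E) (ξ : Fin d → ℝ) : ‖fourierSeries a ξ‖ ≤ ∑ k ∈ a.support, ‖a k‖ := by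
  refine (norm_sum_le _ _).trans (Finset.sum_le_sum fun k _ => ?_)
  have : -Complex.I * ((∑ i, (k i : ℝ) * ξ i : ℝ) : ℂ)
      = ((-∑ i, (k i : ℝ) * ξ i : ℝ) : ℂ) * Complex.I := by
    push_cast
    ring
  rw [norm_smul, this, Complex.norm_exp_ofReal_mul_I, one_mul]

theorem norm_dotProduct_sq_le {ι : Type} [Fintype ι] (y z : ι → ℂ) :
    ‖star y ⬝ᵥ z‖ ^ 2 ≤ euclSq y * euclSq z := by
  calc ‖star y ⬝ᵥ z‖ ^ 2 ≤ (∑ i, ‖y i‖ * ‖z i‖) ^ 2 := by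
        gcongr
        refine (norm_sum_le _ _).trans (le_of_eq ?_)
        simp
    _ ≤ _ := Finset.sum_mul_sq_le_sq_mul_sq _ _ _

/-- A synthesis bound for a finite family of vectors gives, by duality, Bessel's inequality with
the same constant. -/
theorem sum_norm_dotProduct_sq_le {ι κ : Type} [Fintype ι] [Fintype κ] {f : κ → ι → ℂ} {B : ℝ}
    (hB : 0 ≤ B) (hf : ∀ a : κ → ℂ, euclSq (∑ j, a j • f j) ≤ B * ∑ j, ‖a j‖ ^ 2) (y : ι → ℂ) :
    ∑ j, ‖star y ⬝ᵥ f j‖ ^ 2 ≤ B * euclSq y := by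
  set t := ∑ j, ‖star y ⬝ᵥ f j‖ ^ 2 with ht
  have ht0 : 0 ≤ t := Finset.sum_nonneg fun _ _ => sq_nonneg _
  have h1 : star y ⬝ᵥ (∑ j, star (star y ⬝ᵥ f j) • f j) = (t : ℂ) := by
    rw [dotProduct_sum, ht]
    push_cast
    refine Finset.sum_congr rfl fun j _ => ?_
    rw [dotProduct_smul, smul_eq_mul, Complex.star_def, Complex.conj_mul']
  have h2 := norm_dotProduct_sq_le y (∑ j, star (star y ⬝ᵥ f j) • f j)
  have h3 := hf fun j => star (star y ⬝ᵥ f j)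
  simp only [norm_star] at h3
  rw [h1, Complex.norm_real, Real.norm_of_nonneg ht0] at h2
  have h4 : t ^ 2 ≤ t * (B * euclSq y) := by
    calc t ^ 2 ≤ _ := h2
      _ ≤ euclSq y * (B * t) := mul_le_mul_of_nonneg_left h3 (euclSq_nonneg y)
      _ = _ := by ring
  rcases ht0.eq_or_lt with h | h
  · rw [← h]
    exact mul_nonneg hB (euclSq_nonneg y)
  · rw [sq] at h4
    exact le_of_mul_le_mul_left h4 h

/-- The synthesis bound for the integer shifts of `ψ̂⁰`, inherited from the fibers of the cascade
products in the limit. -/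
theorem euclSq_sum_psiHatZero_le {d r : ℕ} {M₀ : Matrix (Fin d) (Fin d) ℤ} (hM : IsDilation M₀)
    {b₀ : FinFilter d (Matrix (Fin r) (Fin r) ℂ)} {u : FinFilter d (Fin r → ℂ)} {C U : ℝ}
    (hC : 0 ≤ C)
    (hb : ∀ n, 1 ≤ n → ∀ v : (Fin d → ℤ) → Fin r → ℂ, sqNorm v < ∞ →
      sqNorm (lowPass M₀ b₀ v n) ≤ ENNReal.ofReal C * sqNorm v)
    (hU : ∀ ξ, euclSq (fourierSeries u ξ) ≤ U)
    (hlim : ∀ ξ, Tendsto (fun n => partialProduct M₀ b₀ u n ξ) atTop (𝓝 (psiHatZero M₀ b₀ u ξ)))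
    (ξ : Fin d → ℝ) (K : Finset (Fin d → ℤ)) (a : K → ℂ) :
    euclSq (∑ k, a k • psiHatZero M₀ b₀ u (shift ξ k)) ≤ C * U * ∑ k, ‖a k‖ ^ 2 := by
  have hcont : Continuous (euclSq : (Fin r → ℂ) → ℝ) := by
    unfold euclSq
    fun_prop
  have h1 : Tendsto (fun n => euclSq (∑ k, a k • partialProduct M₀ b₀ u n (shift ξ k))) atTop
      (𝓝 (euclSq (∑ k, a k • psiHatZero M₀ b₀ u (shift ξ k)))) :=
    (hcont.tendsto _).comp (tendsto_finsetSum _ fun k _ => (hlim _).const_smul (a k))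
  refine le_of_tendsto h1 ?_
  have hdist : ∀ᶠ n in atTop, ∀ k k' : K, k ≠ k' → ∀ l : Fin d → ℤ,
      (k : Fin d → ℤ) - (k' : Fin d → ℤ) ≠ (M₀ ^ n)ᵀ *ᵥ l := by
    refine eventually_all.2 fun k => eventually_all.2 fun k' => ?_
    by_cases hk : k = k'
    · exact Eventually.of_forall fun n h => absurd hk h
    · filter_upwards [hM.eventually_sub_ne (fun h => hk (Subtype.ext h))] with n hn _
      exact hn
  filter_upwards [hdist, eventually_ge_atTop 1] with n hn hn1
  have h2 := euclSq_sum_cascade_le hM.det_ne_zero hC (hb n hn1) ξ (fun k : K => (k : Fin d → ℤ)) hn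
    (fun k => a k • fourierSeries u ((invTransR M₀ ^ n) *ᵥ shift ξ k))
  simp only [Matrix.mulVec_smul] at h2
  refine h2.trans ?_
  rw [mul_assoc, Finset.mul_sum _ _ U]
  gcongr with k
  rw [euclSq_smul, mul_comm]
  gcongr
  exact hU _

section Bracket

variable {d r : ℕ} {ψ : (Fin d → ℝ) → Fin r → ℂ} {B : ℝ} {ξ : Fin d → ℝ}

theorem summable_norm_dotProduct_shift
    (h : ∀ (K : Finset (Fin d → ℤ)) (y : Fin r → ℂ),
      ∑ k ∈ K, ‖star y ⬝ᵥ ψ (shift ξ k)‖ ^ 2 ≤ B * euclSq y) (y : Fin r → ℂ) :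
    Summable fun k => ‖star y ⬝ᵥ ψ (shift ξ k)‖ ^ 2 :=
  summable_of_sum_le (fun _ => sq_nonneg _) fun K => h K y

theorem summable_bracketTerm
    (h : ∀ (K : Finset (Fin d → ℤ)) (y : Fin r → ℂ),
      ∑ k ∈ K, ‖star y ⬝ᵥ ψ (shift ξ k)‖ ^ 2 ≤ B * euclSq y) :
    Summable (bracketTerm ψ ψ ξ) := by
  have hi : ∀ i, Summable fun k => ‖ψ (shift ξ k) i‖ ^ 2 := by
    intro i
    have := summable_norm_dotProduct_shift h (Pi.single i 1)
    simpa [← Pi.single_star] using this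
  refine Pi.summable.2 fun i => Pi.summable.2 fun j => ?_
  refine Summable.of_norm_bounded ((hi i).add (hi j)) fun k => ?_
  rw [bracketTerm, vecMulVec_apply, norm_mul, Pi.star_apply, norm_star]
  nlinarith [sq_nonneg (‖ψ (shift ξ k) i‖ - ‖ψ (shift ξ k) j‖), sq_nonneg ‖ψ (shift ξ k) i‖,
    sq_nonneg ‖ψ (shift ξ k) j‖]

theorem posSemidef_smul_one_sub_bracket {C : ℝ} (hBC : B ≤ C)
    (h : ∀ (K : Finset (Fin d → ℤ)) (y : Fin r → ℂ),
      ∑ k ∈ K, ‖star y ⬝ᵥ ψ (shift ξ k)‖ ^ 2 ≤ B * euclSq y) :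
    ((C : ℂ) • (1 : Matrix (Fin r) (Fin r) ℂ) - bracket ψ ψ ξ).PosSemidef := by
  have hs := summable_bracketTerm h
  refine Matrix.PosSemidef.of_dotProduct_mulVec_nonneg ?_ fun y => ?_
  · refine Matrix.IsHermitian.sub ?_ ?_
    · simp [Matrix.IsHermitian, Matrix.conjTranspose_smul]
    · rw [Matrix.IsHermitian, bracket, Matrix.conjTranspose_tsum]
      refine tsum_congr fun k => ?_
      rw [bracketTerm, Matrix.conjTranspose_vecMulVec, star_star]
  · let g : Matrix (Fin r) (Fin r) ℂ →+ ℂ :=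
      { toFun := fun A => star y ⬝ᵥ (A *ᵥ y)
        map_zero' := by simp
        map_add' := fun A A' => by rw [Matrix.add_mulVec, dotProduct_add] }
    have hg : Continuous g := by
      change Continuous fun A : Matrix (Fin r) (Fin r) ℂ => star y ⬝ᵥ (A *ᵥ y)
      fun_prop
    have hterm : ∀ k, g (bracketTerm ψ ψ ξ k) = ((‖star y ⬝ᵥ ψ (shift ξ k)‖ ^ 2 : ℝ) : ℂ) := by
      intro k
      change star y ⬝ᵥ (vecMulVec _ _ *ᵥ y) = _
      rw [Matrix.vecMulVec_mulVec, dotProduct_smul]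
      have : star (ψ (shift ξ k)) ⬝ᵥ y = star (star y ⬝ᵥ ψ (shift ξ k)) := by
        rw [Matrix.star_dotProduct]
      rw [this]
      push_cast
      rw [← Complex.mul_conj']
      rfl
    have hsum : g (bracket ψ ψ ξ) = ((∑' k, ‖star y ⬝ᵥ ψ (shift ξ k)‖ ^ 2 : ℝ) : ℂ) := by
      rw [bracket, ← (hs.hasSum.map g hg).tsum_eq, Complex.ofReal_tsum]
      exact tsum_congr hterm
    have hle : ∑' k, ‖star y ⬝ᵥ ψ (shift ξ k)‖ ^ 2 ≤ C * euclSq y :=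
      ((summable_norm_dotProduct_shift h y).tsum_le_of_sum_le fun K => h K y).trans
        (mul_le_mul_of_nonneg_right hBC (euclSq_nonneg y))
    have hval : star y ⬝ᵥ (((C : ℂ) • (1 : Matrix (Fin r) (Fin r) ℂ) - bracket ψ ψ ξ) *ᵥ y)
        = ((C * euclSq y - ∑' k, ‖star y ⬝ᵥ ψ (shift ξ k)‖ ^ 2 : ℝ) : ℂ) := by
      rw [Matrix.sub_mulVec, dotProduct_sub, Matrix.smul_mulVec, Matrix.one_mulVec,
        dotProduct_smul, Complex.ofReal_sub, ← hsum, Complex.ofReal_mul, ofReal_euclSq,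
        dotProduct_comm (star y) y]
      rfl
    rw [hval]
    exact_mod_cast sub_nonneg.2 hle

/-- A bound for the trace of the bracket product, by testing on the standard basis. -/
theorem tsum_euclSq_shift_le
    (h : ∀ (K : Finset (Fin d → ℤ)) (y : Fin r → ℂ),
      ∑ k ∈ K, ‖star y ⬝ᵥ ψ (shift ξ k)‖ ^ 2 ≤ B * euclSq y) :
    ∑' k, ENNReal.ofReal (euclSq (ψ (shift ξ k))) ≤ ENNReal.ofReal (r * B) := by
  refine ENNReal.summable.tsum_le_of_sum_le fun K => ?_
  rw [← ENNReal.ofReal_sum_of_nonneg fun _ _ => euclSq_nonneg _]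
  refine ENNReal.ofReal_le_ofReal ?_
  simp only [euclSq]
  rw [Finset.sum_comm]
  calc ∑ i, ∑ k ∈ K, ‖ψ (shift ξ k) i‖ ^ 2 ≤ ∑ _i : Fin r, B := by
        refine Finset.sum_le_sum fun i _ => ?_
        have := h K (Pi.single i 1)
        simpa [← Pi.single_star, euclSq, Pi.single_apply, apply_ite] using this
    _ = r * B := by simp

end Bracket

/-! ### Sums over rational lattices -/

/-- If the sums of `f` over all translates of `2πℤᵈ` are at most `B`, then the sums over the
translates of a sublattice `2πAℤᵈ` of `2πn⁻¹ℤᵈ` are at most `nᵈ B`, since `n⁻¹ℤᵈ` consists of `nᵈ`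
classes modulo `ℤᵈ`. -/
theorem tsum_mulVec_shift_le {d : ℕ} {f : (Fin d → ℝ) → ℝ≥0∞} {B : ℝ≥0∞}
    (hf : ∀ ζ, ∑' k, f (shift ζ k) ≤ B) {A : Matrix (Fin d) (Fin d) ℝ}
    {A' : Matrix (Fin d) (Fin d) ℤ} (hA' : A'.det ≠ 0) {n : ℕ} [NeZero n]
    (hA : (n : ℝ) • A = A'.map (Int.cast : ℤ → ℝ)) (ξ : Fin d → ℝ) :
    ∑' k, f (A *ᵥ shift ξ k) ≤ (n : ℝ≥0∞) ^ d * B := by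
  have hn : (n : ℝ) ≠ 0 := NeZero.ne _
  let g : (Fin d → Fin n) × (Fin d → ℤ) → ℝ≥0∞ := fun p =>
    f (shift (fun i => (A *ᵥ ξ) i + 2 * Real.pi * ((p.1 i : ℕ) : ℝ) / n) p.2)
  let φ : (Fin d → ℤ) → (Fin d → Fin n) × (Fin d → ℤ) := fun k =>
    (fun i => (Int.divModEquiv n ((A' *ᵥ k) i)).2, fun i => (Int.divModEquiv n ((A' *ᵥ k) i)).1)
  have hφ : Function.Injective φ := by
    intro k k' h
    refine Matrix.mulVec_injective_of_det_ne_zero hA' (funext fun i => ?_)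
    refine (Int.divModEquiv n).injective (Prod.ext ?_ ?_)
    · exact congrFun (congrArg Prod.snd h) i
    · exact congrFun (congrArg Prod.fst h) i
  have hg : ∀ k, f (A *ᵥ shift ξ k) = g (φ k) := by
    intro k
    refine congrArg f (funext fun i => ?_)
    have h1 : (n : ℝ) * (A *ᵥ fun i => (k i : ℝ)) i = ((A' *ᵥ k) i : ℝ) := by
      have : (n : ℝ) • (A *ᵥ fun i => (k i : ℝ)) = A'.map (Int.cast : ℤ → ℝ) *ᵥ fun i => (k i : ℝ) := by
        rw [← Matrix.smul_mulVec, hA]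
      have h2 := congrFun this i
      rw [Pi.smul_apply, smul_eq_mul] at h2
      rw [h2]
      simp [Matrix.mulVec, dotProduct]
    have h2 : ((A' *ᵥ k) i : ℝ) = ((φ k).2 i : ℝ) * n + (((φ k).1 i : ℕ) : ℝ) := by
      have := (Int.divModEquiv n).symm_apply_apply ((A' *ᵥ k) i)
      rw [Int.divModEquiv_symm_apply] at this
      exact_mod_cast this.symm
    have h3 : (A *ᵥ shift ξ k) i
        = (A *ᵥ ξ) i + 2 * Real.pi * (A *ᵥ fun i => (k i : ℝ)) i := by
      rw [shift_eq_add, Matrix.mulVec_add, Pi.add_apply]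
      have : (fun i => 2 * Real.pi * (k i : ℝ)) = (2 * Real.pi) • fun i => (k i : ℝ) := rfl
      rw [this, Matrix.mulVec_smul, Pi.smul_apply, smul_eq_mul]
    rw [h3, shift]
    have h4 : (A *ᵥ fun i => (k i : ℝ)) i = ((φ k).2 i : ℝ) + (((φ k).1 i : ℕ) : ℝ) / n := by
      field_simp
      rw [mul_comm, h1, h2]
    rw [h4]
    ring
  calc ∑' k, f (A *ᵥ shift ξ k) = ∑' k, g (φ k) := tsum_congr hg
    _ ≤ ∑' p, g p := ENNReal.tsum_comp_le_tsum_of_injective hφ g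
    _ = ∑' e, ∑' q, g (e, q) := ENNReal.tsum_prod (f := fun e q => g (e, q))
    _ ≤ ∑' _e : Fin d → Fin n, B := ENNReal.tsum_le_tsum fun e =>
        hf fun i => (A *ᵥ ξ) i + 2 * Real.pi * ((e i : ℕ) : ℝ) / n
    _ = (n : ℝ≥0∞) ^ d * B := by simp [tsum_fintype]

theorem det_smul_invTransR {d : ℕ} {M : Matrix (Fin d) (Fin d) ℤ} (hM : M.det ≠ 0) :
    (M.det : ℝ) • invTransR M = transR M.adjugate := by
  have h : transR M * transR M.adjugate = (M.det : ℝ) • 1 := by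
    rw [← transR_mul, Matrix.adjugate_mul]
    ext i j
    rw [transR, Matrix.transpose_apply, Matrix.map_apply, Matrix.smul_apply, Matrix.smul_apply]
    simp [Matrix.one_apply, eq_comm]
  have h' := congrArg (invTransR M * ·) h
  simp only [← mul_assoc, mul_eq_one_comm.1 (transR_mul_invTransR hM), one_mul] at h'
  rw [h', Matrix.mul_smul, mul_one]

/-- The matrix `M₀⁻ᵀ M⁻ᵀ M₀ᵀ` is a rational multiple of a nonsingular integer matrix. -/
theorem exists_smul_eq_intMatrix {d : ℕ} {M₀ M : Matrix (Fin d) (Fin d) ℤ} (hM₀ : M₀.det ≠ 0)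
    (hM : M.det ≠ 0) :
    ∃ n : ℕ, n ≠ 0 ∧ ∃ A' : Matrix (Fin d) (Fin d) ℤ, A'.det ≠ 0 ∧
      (n : ℝ) • (invTransR M₀ * (invTransR M * transR M₀)) = A'.map (Int.cast : ℤ → ℝ) := by
  set D : ℤ := M₀.det * M.det with hD
  have hD0 : D ≠ 0 := mul_ne_zero hM₀ hM
  have hadj : ∀ {N : Matrix (Fin d) (Fin d) ℤ}, N.det ≠ 0 → N.adjugate.det ≠ 0 := fun {N} h => by
    rw [Matrix.det_adjugate]
    exact pow_ne_zero _ h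
  -- the square makes the denominator positive
  refine ⟨D.natAbs ^ 2, by positivity, D • (M₀ * M.adjugate * M₀.adjugate)ᵀ, ?_, ?_⟩
  · rw [Matrix.det_smul, Matrix.det_transpose, Matrix.det_mul, Matrix.det_mul]
    exact mul_ne_zero (pow_ne_zero _ hD0) (mul_ne_zero (mul_ne_zero hM₀ (hadj hM)) (hadj hM₀))
  · have h1 : (D.natAbs ^ 2 : ℕ) = (D : ℝ) * (M₀.det * M.det) := by
      push_cast
      rw [Nat.cast_natAbs, Int.cast_abs, sq_abs, hD]
      push_cast
      ring
    have h2 : (D • (M₀ * M.adjugate * M₀.adjugate)ᵀ).map (Int.cast : ℤ → ℝ)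
        = (D : ℝ) • transR (M₀ * M.adjugate * M₀.adjugate) := by
      ext i j
      simp [transR, -zsmul_eq_mul, -Matrix.transpose_mul]
    rw [h1, h2, transR_mul, transR_mul, ← det_smul_invTransR hM₀, ← det_smul_invTransR hM,
      Matrix.smul_mul, Matrix.smul_mul, Matrix.mul_smul, smul_smul, smul_smul,
      mul_assoc]

theorem exists_enorm_psiHat_sq_le {d r : ℕ} (M₀ : Matrix (Fin d) (Fin d) ℤ)
    (b₀ : FinFilter d (Matrix (Fin r) (Fin r) ℂ)) (u : FinFilter d (Fin r → ℂ))
    (bl : FinFilter d (Matrix (Fin 1) (Fin r) ℂ)) :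
    ∃ β : ℝ, 0 ≤ β ∧ ∀ ξ, ‖psiHat M₀ b₀ u bl ξ‖ₑ ^ 2
      ≤ ENNReal.ofReal β * ENNReal.ofReal (euclSq (psiHatZero M₀ b₀ u (invTransR M₀ *ᵥ ξ))) := by
  let _ : NormedAddCommGroup (Matrix (Fin 1) (Fin r) ℂ) := Matrix.linftyOpNormedAddCommGroup
  let _ : NormedSpace ℂ (Matrix (Fin 1) (Fin r) ℂ) := Matrix.linftyOpNormedSpace
  refine ⟨(∑ k ∈ bl.support, ‖bl k‖) ^ 2, sq_nonneg _, fun ξ => ?_⟩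
  rw [← ENNReal.ofReal_mul (sq_nonneg _), ← ofReal_norm, ← ENNReal.ofReal_pow (norm_nonneg _)]
  refine ENNReal.ofReal_le_ofReal ?_
  set x := psiHatZero M₀ b₀ u (invTransR M₀ *ᵥ ξ) with hx
  have h1 : ‖psiHat M₀ b₀ u bl ξ‖ ≤ (∑ k ∈ bl.support, ‖bl k‖) * ‖x‖ :=
    ((norm_le_pi_norm _ 0).trans (Matrix.linfty_opNorm_mulVec _ _)).trans
      (mul_le_mul_of_nonneg_right (norm_fourierSeries_le bl _) (norm_nonneg _))
  calc ‖psiHat M₀ b₀ u bl ξ‖ ^ 2 ≤ ((∑ k ∈ bl.support, ‖bl k‖) * ‖x‖) ^ 2 := by gcongr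
    _ = (∑ k ∈ bl.support, ‖bl k‖) ^ 2 * ‖x‖ ^ 2 := mul_pow _ _ _
    _ ≤ _ := by gcongr; exact norm_sq_le_euclSq x

/-- A common bound for the high-pass sums, given the bound on the bracket product of `ψ̂⁰`. -/
theorem exists_tsum_enorm_psiHat_sq_le {d r : ℕ} {M₀ M : Matrix (Fin d) (Fin d) ℤ}
    (hM₀ : M₀.det ≠ 0) (hM : M.det ≠ 0)
    {b₀ : FinFilter d (Matrix (Fin r) (Fin r) ℂ)} {u : FinFilter d (Fin r → ℂ)}
    (bl : FinFilter d (Matrix (Fin 1) (Fin r) ℂ)) {B : ℝ}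
    (hB : ∀ ξ, ∑' k, ENNReal.ofReal (euclSq (psiHatZero M₀ b₀ u (shift ξ k)))
      ≤ ENNReal.ofReal B) :
    ∃ T : ℝ, 0 ≤ T ∧ ∀ ξ, ∑' k, ‖psiHat M₀ b₀ u bl ((invTransR M * transR M₀) *ᵥ shift ξ k)‖ₑ ^ 2
      ≤ ENNReal.ofReal T := by
  obtain ⟨n, hn, A', hA', hA⟩ := exists_smul_eq_intMatrix hM₀ hM
  have : NeZero n := ⟨hn⟩
  obtain ⟨β, hβ, hle⟩ := exists_enorm_psiHat_sq_le M₀ b₀ u bl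
  set c : ℝ≥0∞ := ENNReal.ofReal β * ((n : ℝ≥0∞) ^ d * ENNReal.ofReal B) with hc
  have hctop : c ≠ ∞ := by
    rw [hc]
    finiteness
  refine ⟨c.toReal, ENNReal.toReal_nonneg, fun ξ => ?_⟩
  rw [ENNReal.ofReal_toReal hctop]
  refine (ENNReal.tsum_le_tsum fun k => hle _).trans ?_
  rw [ENNReal.tsum_mul_left]
  simp only [Matrix.mulVec_mulVec]
  exact mul_le_mul_right (tsum_mulVec_shift_le
    (f := fun ζ => ENNReal.ofReal (euclSq (psiHatZero M₀ b₀ u ζ))) hB hA' hA ξ) _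

end MixedFramelet

end

/-! ### Bounds for the refinable vector function and the framelets -/

theorem mainTheorem10 {d r s : ℕ}
    (M₀ : Matrix (Fin d) (Fin d) ℤ) (M : Fin s → Matrix (Fin d) (Fin d) ℤ)
    (hM₀ : MixedFramelet.IsDilation M₀) (hM : ∀ l, MixedFramelet.IsDilation (M l))
    (b₀ : MixedFramelet.FinFilter d (Matrix (Fin r) (Fin r) ℂ))
    (b : Fin s → MixedFramelet.FinFilter d (Matrix (Fin 1) (Fin r) ℂ))
    (u : MixedFramelet.FinFilter d (Fin r → ℂ))
    -- a norm on the `r × r` matrices, submultiplicative or not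
    (N : Seminorm ℂ (Matrix (Fin r) (Fin r) ℂ)) (hN : ∀ A, N A = 0 → A = 0)
    (C₀ Cb τ : ℝ) (hC₀ : 0 < C₀) (hCb : 0 < Cb) (hτ : 0 < τ)
    (hnorm : Real.logb 2 (N (MixedFramelet.fourierSeries b₀ 0) + C₀) ≤ τ)
    (hu : ∀ ξ : Fin d → ℝ, (∀ i, ξ i ∈ Set.Icc (-Real.pi) Real.pi) →
      ‖MixedFramelet.fourierSeries b₀ ξ *ᵥ MixedFramelet.fourierSeries u ξ
          - MixedFramelet.fourierSeries u (MixedFramelet.transR M₀ *ᵥ ξ)‖ ≤ Cb * ‖ξ‖ ^ τ)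
    (hstab : MixedFramelet.HasStability M₀ M b₀ b) :
    (∀ ξ : Fin d → ℝ,
      Tendsto (fun n => MixedFramelet.partialProduct M₀ b₀ u n ξ) atTop
        (𝓝 (MixedFramelet.psiHatZero M₀ b₀ u ξ))) ∧
    ∃ C : ℝ, 0 < C ∧
      (∀ᵐ ξ : Fin d → ℝ,
        Summable (MixedFramelet.bracketTerm (MixedFramelet.psiHatZero M₀ b₀ u)
          (MixedFramelet.psiHatZero M₀ b₀ u) ξ) ∧
        ((C : ℂ) • (1 : Matrix (Fin r) (Fin r) ℂ)
          - MixedFramelet.bracket (MixedFramelet.psiHatZero M₀ b₀ u)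
              (MixedFramelet.psiHatZero M₀ b₀ u) ξ).PosSemidef) ∧
      (∀ᵐ ξ : Fin d → ℝ,
        ∑ l : Fin s, ∑' k : Fin d → ℤ,
          ‖MixedFramelet.psiHat M₀ b₀ u (b l)
            ((MixedFramelet.invTransR (M l) * MixedFramelet.transR M₀) *ᵥ
              MixedFramelet.shift ξ k)‖ₑ ^ 2 ≤ ENNReal.ofReal C) := by
  have hdet := hM₀.det_ne_zero
  obtain ⟨_, C₂, -, hC₂, hst⟩ := hstab
  have hlow : ∀ n, 1 ≤ n → ∀ v : (Fin d → ℤ) → Fin r → ℂ, MixedFramelet.sqNorm v < ∞ →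
      MixedFramelet.sqNorm (MixedFramelet.lowPass M₀ b₀ v n)
        ≤ ENNReal.ofReal C₂ * MixedFramelet.sqNorm v := fun n hn v hv =>
    (MixedFramelet.sqNorm_lowPass_le M₀ M b₀ b n v).trans (hst n hn v hv).2
  -- the fiber bound for a single frequency bounds the cascade products uniformly in their length
  have hcasc : ∀ ξ n, 1 ≤ n → ∀ x,
      MixedFramelet.euclSq (MixedFramelet.cascade M₀ b₀ n ξ *ᵥ x)
        ≤ C₂ * MixedFramelet.euclSq x := by
    intro ξ n hn x
    have h := MixedFramelet.euclSq_sum_cascade_le (κ := Unit) hdet hC₂.le (hlow n hn) ξ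
      (fun _ => 0) (fun j j' hj => absurd (Subsingleton.elim j j') hj) (fun _ => x)
    have hξ : MixedFramelet.shift ξ 0 = ξ := by
      ext i
      simp [MixedFramelet.shift]
    simpa [hξ] using h
  have hlim : ∀ ξ : Fin d → ℝ, Tendsto (fun n => MixedFramelet.partialProduct M₀ b₀ u n ξ) atTop
      (𝓝 (MixedFramelet.psiHatZero M₀ b₀ u ξ)) := fun ξ =>
    MixedFramelet.tendsto_partialProduct hM₀ hτ hCb.le hu (hcasc ξ)
  refine ⟨hlim, ?_⟩
  obtain ⟨U, hU0, hU⟩ : ∃ U : ℝ, 0 ≤ U ∧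
      ∀ ξ, MixedFramelet.euclSq (MixedFramelet.fourierSeries u ξ) ≤ U := by
    refine ⟨r * (∑ k ∈ u.support, ‖u k‖) ^ 2, by positivity, fun ξ => ?_⟩
    refine (MixedFramelet.euclSq_le_card_mul_norm_sq _).trans ?_
    gcongr
    exact MixedFramelet.norm_fourierSeries_le u ξ
  have hbessel : ∀ (ξ : Fin d → ℝ) (K : Finset (Fin d → ℤ)) (y : Fin r → ℂ),
      ∑ k ∈ K, ‖star y ⬝ᵥ MixedFramelet.psiHatZero M₀ b₀ u (MixedFramelet.shift ξ k)‖ ^ 2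
        ≤ C₂ * U * MixedFramelet.euclSq y := by
    intro ξ K y
    rw [← Finset.sum_coe_sort]
    exact MixedFramelet.sum_norm_dotProduct_sq_le (mul_nonneg hC₂.le hU0)
      (MixedFramelet.euclSq_sum_psiHatZero_le hM₀ hC₂.le hlow hU hlim ξ K) y
  choose T hT0 hT using fun l => MixedFramelet.exists_tsum_enorm_psiHat_sq_le hdet
    (hM l).det_ne_zero (b l) fun ξ => MixedFramelet.tsum_euclSq_shift_le (hbessel ξ)
  have hTsum : 0 ≤ ∑ l, T l := Finset.sum_nonneg fun l _ => hT0 l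
  have hCU : 0 ≤ C₂ * U := mul_nonneg hC₂.le hU0
  refine ⟨C₂ * U + ∑ l, T l + 1, by positivity, Eventually.of_forall fun ξ => ⟨?_, ?_⟩,
    Eventually.of_forall fun ξ => ?_⟩
  · exact MixedFramelet.summable_bracketTerm (hbessel ξ)
  · exact MixedFramelet.posSemidef_smul_one_sub_bracket (by linarith) (hbessel ξ)
  · calc _ ≤ ∑ l, ENNReal.ofReal (T l) := Finset.sum_le_sum fun l _ => hT l ξ
      _ = ENNReal.ofReal (∑ l, T l) := (ENNReal.ofReal_sum_of_nonneg fun l _ => hT0 l).symm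
      _ ≤ _ := ENNReal.ofReal_le_ofReal (by linarith)
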